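/- Let $n\ge 1$, $f(x)=\|x\|_2^2$ on $\mathbb R^n$, $\mu\in\mathbb R^n$ unknown, $\varepsilon>0$ and $\delta\in(0,1)$. There are $n$ arms; every pull of arm $i$ returns $\mu_i+Z$ with a fresh noise $Z$, where all noises are independent standard normal. Consider the following algorithm. Put $$B_0=\frac{34\,n^{3/2}\log(12n/\delta)}{\varepsilon}.$$ In rounds $r=1,2,\dots$, with budget $B_r=2^rB_0$: 1. Pull each arm $\lceil B_r/n\rceil$ times; let $\tilde B_r=\sum_{\ell=1}^r\lceil B_\ell/n\rceil$, let $\hat\mu_i^{(r)}$ be the average of the $\tilde B_r$ samples of arm $i$ obtained in this way in rounds $1,\dots,r$, and let $C_r=\sqrt{2\log(12nr^2/\delta)/\tilde B_r}$. 2. Let $\hat g_i^{(r,L)}=(|\hat\mu_i^{(r)}|-4C_r)_+$ and $\hat g_i^{(r,U)}=2|\hat\mu_i^{(r)}|+2C_r$. Let $\alpha^{(r)}$ be the probability vector proportional to $(\hat g_i^{(r,L)})_i$ (the uniform one if all of these vanish), and $\tilde T_i=\lceil(\alpha_i^{(r)}+\tfrac1n)B_r\rceil$. 3. If $\sum_i(\hat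 g_i^{(r,U)})^2/\tilde T_i\le \varepsilon^2/(16\log(6/\delta))$, pull each arm $i$ another $\tilde T_i$ times, let $\tilde\mu_i$ be the average of these new samples, return $\|\tilde\mu\|_2^2-\sum_{i=1}^n 1/\tilde T_i$ and stop. Otherwise go on to round $r+1$. Then there is a universal constant $C$ such that, for all $n,\mu,\varepsilon,\delta$ as above, with probability at least $1-\delta$ all of the following hold: the algorithm stops; the value it returns differs from $\|\mu\|_2^2$ by at most $\varepsilon$; and, provided that $B_0\ge n$ (that is, $\varepsilon\le 34\sqrt n\log(12n/\delta)$), the total number of arm pulls is at most $$C\left(\frac{\|\nabla f(\mu)\|_1^2\log(6/\delta)}{\varepsilon^2}+\frac{n^{3/2}\log(12n/\delta)}{\varepsilon}\right),$$ and, if moreover $\delta\le 1/2$, also at most $$C\left(\frac{\|\nabla f(\mu)\|_1^2\log(1/\delta)}{\varepsilon^2}+\frac{n^{3/2}\log(n/\delta)}{\varepsilon}\right).$$ -/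

import Mathlib

open MeasureTheory ProbabilityTheory

noncomputable section

namespace AdaptiveL2

/-- The function to be estimated, `f(x) = ‖x‖₂²`. It is separable, `f(x) = ∑ i, x i ^ 2`, and each
summand has a `2`-Lipschitz derivative. -/
def sqNorm (n : ℕ) (x : EuclideanSpace ℝ (Fin n)) : ℝ := ‖x‖ ^ 2

/-- The complexity `H = ‖∇ f(μ)‖₁` for `f = ‖·‖₂²`. -/
def gradL1 (n : ℕ) (μ : EuclideanSpace ℝ (Fin n)) : ℝ := ∑ i, |gradient (sqNorm n) μ i|

/-! ### The algorithm

Its inputs are the number of arms `n`, the accuracy `ε`, the error probability `δ`, and the table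
`X` of observations: `X i j` is what the `j`-th pull of arm `i` returns (`j = 0, 1, 2, …`). The mean
vector is not an input. Rounds are numbered `r = 1, 2, …`. -/

/-- `B₀ = 17 L n^{3/2} log(12 n / δ) / ε` with the Lipschitz constant `L = 2`. -/
def initBudget (n : ℕ) (ε δ : ℝ) : ℝ :=
  17 * 2 * (n : ℝ) ^ (3 / 2 : ℝ) * Real.log (12 * n / δ) / ε

/-- The round budget `B_r = 2^r B₀`. -/
def roundBudget (n : ℕ) (ε δ : ℝ) (r : ℕ) : ℝ := initBudget n ε δ * 2 ^ r

/-- The number `⌈B_r / n⌉` of times each arm is pulled in the uniform phase of round `r`. -/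
def unifPulls (n : ℕ) (ε δ : ℝ) (r : ℕ) : ℕ := ⌈roundBudget n ε δ r / n⌉₊

/-- The number of uniform pulls of each arm in rounds `1, …, r`. -/
def cumPulls (n : ℕ) (ε δ : ℝ) (r : ℕ) : ℕ := ∑ l ∈ Finset.Icc 1 r, unifPulls n ε δ l

/-- The confidence width `C_r`. -/
def confWidth (n : ℕ) (ε δ : ℝ) (r : ℕ) : ℝ :=
  √(2 * Real.log (12 * n * (r : ℝ) ^ 2 / δ) / cumPulls n ε δ r)

/-- The average of all uniform samples of arm `i` from rounds `1, …, r`. -/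
def muHat {n : ℕ} (X : Fin n → ℕ → ℝ) (ε δ : ℝ) (r : ℕ) (i : Fin n) : ℝ :=
  (∑ j ∈ Finset.range (cumPulls n ε δ r), X i j) / cumPulls n ε δ r

/-- The separable lower gradient bound `(|μ̂_i| - 4 C_r)₊`. -/
def gradLower {n : ℕ} (X : Fin n → ℕ → ℝ) (ε δ : ℝ) (r : ℕ) (i : Fin n) : ℝ :=
  max (|muHat X ε δ r i| - 4 * confWidth n ε δ r) 0

/-- The separable upper gradient bound `|∇_i f(μ̂)| + L C_r = 2 |μ̂_i| + 2 C_r`. -/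
def gradUpper {n : ℕ} (X : Fin n → ℕ → ℝ) (ε δ : ℝ) (r : ℕ) (i : Fin n) : ℝ :=
  2 * |muHat X ε δ r i| + 2 * confWidth n ε δ r

/-- The upper bound is the maximum of the absolute partial derivative `|d(y²)/dy|` over the
confidence interval `|y - μ̂_i| ≤ C_r`. -/
theorem isGreatest_gradUpper {n : ℕ} (X : Fin n → ℕ → ℝ) (ε δ : ℝ) (r : ℕ) (i : Fin n) :
    IsGreatest
      ((fun y : ℝ => |deriv (fun t : ℝ => t ^ 2) y|) ''
        {y : ℝ | |y - muHat X ε δ r i| ≤ confWidth n ε δ r})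
      (gradUpper X ε δ r i) := by
  have hC : 0 ≤ confWidth n ε δ r := Real.sqrt_nonneg _
  unfold gradUpper
  generalize muHat X ε δ r i = m at *
  generalize confWidth n ε δ r = c at *
  have hd : ∀ y : ℝ, |deriv (fun t : ℝ => t ^ 2) y| = 2 * |y| := by
    intro y
    simp [abs_mul]
  constructor
  · rcases le_total 0 m with h | h
    · refine ⟨m + c, ?_, ?_⟩
      · simp [abs_of_nonneg hC]
      · simp only [hd]
        rw [abs_of_nonneg h, abs_of_nonneg (by linarith)]
        ring
    · refine ⟨m - c, ?_, ?_⟩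
      · simp [abs_of_nonneg hC]
      · simp only [hd]
        rw [abs_of_nonpos h, abs_of_nonpos (by linarith)]
        ring
  · rintro _ ⟨y, hy, rfl⟩
    have hy' : |y - m| ≤ c := hy
    have h1 : |y| ≤ |y - m| + |m| := by simpa using abs_add_le (y - m) m
    simp only [hd]
    linarith

/-- The sampling frequencies: the probability vector proportional to the lower gradient bounds
(uniform when all of these vanish). -/
def freq {n : ℕ} (X : Fin n → ℕ → ℝ) (ε δ : ℝ) (r : ℕ) (i : Fin n) : ℝ :=
  if ∑ k, gradLower X ε δ r k = 0 then 1 / n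
  else gradLower X ε δ r i / ∑ k, gradLower X ε δ r k

/-- `T̃_i = ⌈(α_i + 1/n) B_r⌉`. -/
def finalPulls {n : ℕ} (X : Fin n → ℕ → ℝ) (ε δ : ℝ) (r : ℕ) (i : Fin n) : ℕ :=
  ⌈(freq X ε δ r i + 1 / n) * roundBudget n ε δ r⌉₊

/-- The termination condition checked at the end of round `r`. -/
def StopCond {n : ℕ} (X : Fin n → ℕ → ℝ) (ε δ : ℝ) (r : ℕ) : Prop :=
  ∑ i, gradUpper X ε δ r i ^ 2 / finalPulls X ε δ r i ≤ ε ^ 2 / (16 * Real.log (6 / δ))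

/-- The algorithm terminates in round `r`, the first round whose termination condition holds. -/
def StopsAt {n : ℕ} (X : Fin n → ℕ → ℝ) (ε δ : ℝ) (r : ℕ) : Prop :=
  1 ≤ r ∧ StopCond X ε δ r ∧ ∀ s, 1 ≤ s → s < r → ¬ StopCond X ε δ s

/-- The vector of averages of the fresh final samples, arm `i` being pulled `T̃_i` more times. -/
def muTilde {n : ℕ} (X : Fin n → ℕ → ℝ) (ε δ : ℝ) (r : ℕ) : EuclideanSpace ℝ (Fin n) :=
  WithLp.toLp 2 fun i =>
    (∑ j ∈ Finset.range (finalPulls X ε δ r i), X i (cumPulls n ε δ r + j)) / finalPulls X ε δ r i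

/-- The returned value when terminating in round `r`: the bias-corrected `‖μ̃‖₂² - ∑ i, 1 / T̃_i`. -/
def estimate {n : ℕ} (X : Fin n → ℕ → ℝ) (ε δ : ℝ) (r : ℕ) : ℝ :=
  sqNorm n (muTilde X ε δ r) - ∑ i, 1 / (finalPulls X ε δ r i : ℝ)

/-- The number of all arm pulls (uniform and final ones) when terminating in round `r`. -/
def totalPulls {n : ℕ} (X : Fin n → ℕ → ℝ) (ε δ : ℝ) (r : ℕ) : ℕ :=
  ∑ i, (cumPulls n ε δ r + finalPulls X ε δ r i)

end AdaptiveL2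

end

/-! With `T i` final samples of arm `i`, whose noises average to `W i`, the bias-corrected estimate
errs by exactly `∑ 2 μ i W i + ∑ (W i ^ 2 - 1 / T i)` (`estimate_sub_sqNorm`). The linear part is
Gaussian with variance `∑ (2 μ i)² / T i`. When the confidence intervals hold, `gradUpper` dominates
`2 |μ i|`, so the stopping test bounds this variance. The quadratic part is a centred chi-square
type sum, small because every arm receives at least `B_r / n` final pulls; this fixes the size of
`B₀` (`measure_blockError_gt_le`).

The counts `T` are random, but they depend only on samples drawn before the final phase. Splitting
over the countably many values of (stopping round, `T`), the fixed-`T` bound applies on each piece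
by independence (`measure_stopEvent_inter`), and disjointness of the pieces avoids any union-bound
loss.

For the cost, sampling proportionally to lower bounds `g` on `|μ i|` turns `∑ g² / T` into at most
`(∑ g)² / B`, which is where the squared `ℓ¹` norm of the gradient appears. Together with the decay
of the confidence widths, this makes the test pass once `r ≥ 3` and `B_r` exceeds `64 ‖∇f‖₁²
log(6/δ) / ε²` (`MeansCovered.stopCond`). Budgets double, so the total is a constant multiple of the
last one.

Failure of some interval and inaccuracy of the estimate cost at most `δ / 3` each. -/

noncomputable section

namespace AdaptiveL2

open scoped NNReal ENNReal
open Real (exp log pi)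

/-! ### Gaussian tools: independence of rows, laws of averages, linear and quadratic tail bounds. -/

section Gaussian

variable {Ω : Type*} {mΩ : MeasurableSpace Ω} {P : Measure Ω}

/-- Curried form of independence: the rows of a countable independent table are independent. -/
theorem iIndepFun_rows {ι κ : Type*} [Countable ι] [Countable κ] {X : ι → κ → Ω → ℝ}
    (hX : ∀ i j, Measurable (X i j)) (h : iIndepFun (fun p : ι × κ => X p.1 p.2) P) :
    iIndepFun (fun i ω => (X i · ω)) P := by
  have := h.isProbabilityMeasure
  have h' : iIndepFun (fun p : (_ : ι) × κ => X p.1 p.2) P :=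
    h.precomp (g := Equiv.sigmaEquivProd ι κ) (Equiv.injective _)
  have hrow : ∀ i, iIndepFun (X i) P := fun i =>
    h.precomp (g := fun j : κ => (i, j)) (fun a b hab => by simpa using hab)
  have : ∀ i j, IsProbabilityMeasure (P.map (X i j)) :=
    fun i j ↦ Measure.isProbabilityMeasure_map (hX i j).aemeasurable
  have hcurry : (MeasurableEquiv.piCurry fun (_ : ι) (_ : κ) => ℝ) ∘
      (fun ω (p : (_ : ι) × κ) ↦ X p.1 p.2 ω) = fun ω i j ↦ X i j ω := by
    ext; simp [Sigma.curry]
  -- Independence is read as "joint law = product of the marginals", and product measures are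
  -- transported by currying.
  rw [iIndepFun_iff_map_fun_eq_infinitePi_map (by fun_prop)] at h' ⊢
  have key := congrArg (Measure.map (MeasurableEquiv.piCurry fun (_ : ι) (_ : κ) => ℝ)) h'
  rw [Measure.map_map (by fun_prop) (by fun_prop), hcurry,
    Measure.infinitePi_map_piCurry (fun i j ↦ P.map (X i j))] at key
  rw [key]
  congr with i : 1
  exact ((iIndepFun_iff_map_fun_eq_infinitePi_map (by fun_prop)).1 (hrow i)).symm

/-- Sums of independent standard normal variables. -/
theorem hasLaw_sum_range_gaussianReal [IsProbabilityMeasure P] {W : ℕ → Ω → ℝ}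
    (hW : ∀ j, HasLaw (W j) (gaussianReal 0 1) P) (h : iIndepFun W P) (k : ℕ) :
    HasLaw (fun ω => ∑ j ∈ Finset.range k, W j ω) (gaussianReal 0 k) P := by
  induction k with
  | zero =>
    simp only [Finset.range_zero, Finset.sum_empty, Nat.cast_zero, gaussianReal_zero_var]
    exact hasLaw_dirac_of_ae_eq (Filter.EventuallyEq.refl _ _)
  | succ k ih =>
    have hind := h.indepFun_sum_range_succ₀ (fun j => (hW j).aemeasurable) k
    have hs : (∑ j ∈ Finset.range k, W j) = fun ω => ∑ j ∈ Finset.range k, W j ω := by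
      ext; simp
    rw [hs] at hind
    have := gaussianReal_add_gaussianReal_of_indepFun hind ih.map_eq (hW k).map_eq
    refine ⟨?_, ?_⟩
    · exact Finset.aemeasurable_fun_sum _ fun j _ => (hW j).aemeasurable
    · simp only [Finset.sum_range_succ]
      rw [add_zero] at this
      push_cast
      exact this

/-- Averages of independent standard normal variables. -/
theorem hasLaw_average_gaussianReal [IsProbabilityMeasure P] {W : ℕ → Ω → ℝ}
    (hW : ∀ j, HasLaw (W j) (gaussianReal 0 1) P) (h : iIndepFun W P) (k : ℕ) :
    HasLaw (fun ω => (∑ j ∈ Finset.range k, W j ω) / k) (gaussianReal 0 (1 / k)) P := by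
  have := gaussianReal_div_const (hasLaw_sum_range_gaussianReal hW h k) (k : ℝ)
  convert this using 2
  · simp
  · ext
    rcases eq_or_ne k 0 with rfl | hk
    · simp
    · simp [pow_two]

theorem hasSubgaussianMGF_of_hasLaw_gaussianReal {ξ : Ω → ℝ} {v : ℝ≥0}
    (h : HasLaw ξ (gaussianReal 0 v) P) : HasSubgaussianMGF ξ v P where
  integrable_exp_mul t := by
    have : Integrable (fun x => exp (t * x)) (P.map ξ) := by
      rw [h.map_eq]; exact integrable_exp_mul_gaussianReal t
    exact this.comp_aemeasurable h.aemeasurable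
  mgf_le t := by rw [mgf_gaussianReal h.map_eq]; simp

theorem hasSubgaussianMGF_mono {ξ : Ω → ℝ} {c c' : ℝ≥0} (h : HasSubgaussianMGF ξ c P)
    (hc : c ≤ c') : HasSubgaussianMGF ξ c' P where
  integrable_exp_mul := h.integrable_exp_mul
  mgf_le t := (h.mgf_le t).trans (by gcongr)

theorem hasSubgaussianMGF_const_mul {ξ : Ω → ℝ} {c : ℝ≥0} (h : HasSubgaussianMGF ξ c P) (r : ℝ) :
    HasSubgaussianMGF (fun ω => r * ξ ω) ((r ^ 2).toNNReal * c) P := by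
  rw [Real.toNNReal_of_nonneg (sq_nonneg r)]
  exact h.const_mul r

/-- Two-sided Chernoff bound for a centred sub-Gaussian variable. -/
theorem measure_abs_gt_le_of_hasSubgaussianMGF [IsProbabilityMeasure P] {ξ : Ω → ℝ} {v : ℝ≥0}
    (h : HasSubgaussianMGF ξ v P) {c : ℝ} (hc : 0 ≤ c) :
    P {ω | c < |ξ ω|} ≤ ENNReal.ofReal (2 * exp (-c ^ 2 / (2 * v))) := by
  have h1 := h.measure_ge_le hc
  have h2 := h.neg.measure_ge_le hc
  rw [ENNReal.le_ofReal_iff_toReal_le (measure_ne_top _ _) (by positivity)]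
  calc P.real {ω | c < |ξ ω|} ≤ P.real ({ω | c ≤ ξ ω} ∪ {ω | c ≤ (-ξ) ω}) := by
        refine measureReal_mono fun ω (hω : c < |ξ ω|) => ?_
        rcases lt_abs.1 hω with h | h
        · exact Or.inl h.le
        · exact Or.inr h.le
    _ ≤ _ := measureReal_union_le _ _
    _ ≤ _ := by linarith

/-- Against the density the integrand is again a Gaussian, with rate `1 / (2 v) - s`, positive
exactly when `2 s v < 1`. -/
theorem integrable_exp_mul_sq_gaussianReal {v : ℝ≥0} (hv : v ≠ 0) {s : ℝ} (hs : 2 * s * v < 1) :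
    Integrable (fun x => exp (s * x ^ 2)) (gaussianReal 0 v) := by
  have hv' : (0 : ℝ) < v := by positivity
  rw [gaussianReal_of_var_ne_zero _ hv, integrable_withDensity_iff_integrable_smul']
  · have : (fun x => (gaussianPDF 0 v x).toReal • exp (s * x ^ 2)) =
        fun x => (√(2 * pi * v))⁻¹ * exp (-(1 / (2 * v) - s) * x ^ 2) := by
      ext x
      rw [toReal_gaussianPDF, gaussianPDFReal, smul_eq_mul, mul_assoc, ← Real.exp_add]
      congr 2
      ring
    rw [this]
    refine (integrable_exp_neg_mul_sq ?_).const_mul _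
    rw [sub_pos, lt_div_iff₀ (by positivity)]
    linarith
  · exact measurable_gaussianPDF _ _
  · exact ae_of_all _ fun _ => gaussianPDF_lt_top

/-- The moment generating function of the square of a centred normal variable. -/
theorem integral_exp_mul_sq_gaussianReal {v : ℝ≥0} (hv : v ≠ 0) {s : ℝ} (hs : 2 * s * v < 1) :
    ∫ x, exp (s * x ^ 2) ∂(gaussianReal 0 v) = (√(1 - 2 * s * v))⁻¹ := by
  have hv' : (0 : ℝ) < v := by positivity
  rw [integral_gaussianReal_eq_integral_smul hv]
  have : (fun x => gaussianPDFReal 0 v x • exp (s * x ^ 2)) =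
      fun x => (√(2 * pi * v))⁻¹ * exp (-(1 / (2 * v) - s) * x ^ 2) := by
    ext x
    rw [gaussianPDFReal, smul_eq_mul, mul_assoc, ← Real.exp_add]
    congr 2
    ring
  rw [this, integral_const_mul, integral_gaussian, ← Real.sqrt_inv, ← Real.sqrt_inv,
    ← Real.sqrt_mul (by positivity)]
  congr 1
  have h1 : 1 / (2 * (v : ℝ)) - s = (1 - 2 * s * v) / (2 * v) := by field_simp
  have h2 : 1 - 2 * s * v ≠ 0 := by linarith
  rw [h1]
  field_simp

/-- This is `-log (1 - u) ≤ u + u²`, halved and exponentiated. For `u ≤ 0`, `exp x ≥ 1 + x`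
suffices, since `(1 + u + u²)(1 - u) = 1 - u³`; for `u ≥ 0` the quadratic Taylor term is needed.
With `u = 2 s v` it bounds the moment generating function of a centred Gaussian square. -/
theorem exp_neg_mul_inv_sqrt_le {u : ℝ} (hu : |u| ≤ 1 / 4) :
    exp (-(u / 2)) * (√(1 - u))⁻¹ ≤ exp (u ^ 2 / 2) := by
  obtain ⟨h1, h2⟩ := abs_le.1 hu
  have key : 1 ≤ exp (u + u ^ 2) * (1 - u) := by
    rcases le_total 0 u with h | h
    · have := Real.quadratic_le_exp_of_nonneg (x := u + u ^ 2) (by positivity)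
      calc (1 : ℝ) ≤ (1 + (u + u ^ 2) + (u + u ^ 2) ^ 2 / 2) * (1 - u) := by
            have : 0 ≤ u ^ 2 * (1 - 3 * u) := by
              apply mul_nonneg (sq_nonneg _); linarith
            have h3 : 0 ≤ u ^ 3 * (1 - u) := by
              apply mul_nonneg (by positivity); linarith
            have h4 : 0 ≤ u ^ 4 * (1 - u) := by
              apply mul_nonneg (by positivity); linarith
            nlinarith
        _ ≤ _ := by gcongr; linarith
    · calc (1 : ℝ) ≤ (u + u ^ 2 + 1) * (1 - u) := by
            have : 0 ≤ -u ^ 3 := by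
              have : 0 ≤ (-u) ^ 3 := pow_nonneg (by linarith) 3
              linarith [this, (by ring : (-u) ^ 3 = -u ^ 3)]
            nlinarith
        _ ≤ _ := by gcongr; linarith; exact Real.add_one_le_exp _
  have hs : 0 < √(1 - u) := Real.sqrt_pos.2 (by linarith)
  have h3 : 1 ≤ exp ((u + u ^ 2) / 2) * √(1 - u) := by
    rw [Real.exp_half, ← Real.sqrt_mul (Real.exp_pos _).le]
    exact Real.one_le_sqrt.2 key
  rw [← div_eq_mul_inv, div_le_iff₀ hs]
  calc exp (-(u / 2)) = exp (-(u / 2)) * 1 := by ring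
    _ ≤ exp (-(u / 2)) * (exp ((u + u ^ 2) / 2) * √(1 - u)) := by gcongr
    _ = exp (u ^ 2 / 2) * √(1 - u) := by
      rw [← mul_assoc, ← Real.exp_add]; congr 2; ring

theorem integrable_exp_mul_centered_sq {ξ : Ω → ℝ} {v : ℝ≥0} (hv : v ≠ 0)
    (h : HasLaw ξ (gaussianReal 0 v) P) {s : ℝ} (hs : |2 * s * v| ≤ 1 / 4) :
    Integrable (fun ω => exp (s * (ξ ω ^ 2 - v))) P := by
  have h1 : Integrable (fun x => exp (s * x ^ 2)) (P.map ξ) := by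
    rw [h.map_eq]
    exact integrable_exp_mul_sq_gaussianReal hv (by linarith [le_abs_self (2 * s * v)])
  have h2 := (h1.comp_aemeasurable h.aemeasurable).const_mul (exp (-(s * v)))
  refine h2.congr (ae_of_all _ fun ω => ?_)
  simp only [Function.comp, ← Real.exp_add]
  congr 1
  ring

theorem mgf_centered_sq_le {ξ : Ω → ℝ} {v : ℝ≥0} (hv : v ≠ 0)
    (h : HasLaw ξ (gaussianReal 0 v) P) {s : ℝ} (hs : |2 * s * v| ≤ 1 / 4) :
    mgf (fun ω => ξ ω ^ 2 - v) P s ≤ exp (2 * s ^ 2 * v ^ 2) := by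
  have hs' : 2 * s * v < 1 := by linarith [le_abs_self (2 * s * v)]
  have : mgf (fun ω => ξ ω ^ 2 - v) P s = exp (-(2 * s * v / 2)) * (√(1 - 2 * s * v))⁻¹ := by
    rw [← integral_exp_mul_sq_gaussianReal hv hs', ← integral_const_mul, mgf]
    rw [← h.integral_comp (f := fun x => exp (-(2 * s * v / 2)) * exp (s * x ^ 2))
      (by fun_prop)]
    congr with ω
    simp only [Function.comp, ← Real.exp_add]
    congr 1
    ring
  rw [this]
  refine (exp_neg_mul_inv_sqrt_le hs).trans_eq ?_
  congr 1
  ring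

/-- Deviations of a sum of squares of independent centred normal variables from its mean. -/
theorem measure_abs_sum_centered_sq_gt_le [IsProbabilityMeasure P] {ι : Type*} [Fintype ι]
    {ξ : ι → Ω → ℝ} (hm : ∀ i, Measurable (ξ i)) {v : ι → ℝ≥0} (hv : ∀ i, v i ≠ 0)
    (hξ : ∀ i, HasLaw (ξ i) (gaussianReal 0 (v i)) P) (h : iIndepFun ξ P)
    {t : ℝ} (ht : 0 ≤ t) (htv : ∀ i, 2 * t * v i ≤ 1 / 4) (c : ℝ) :
    P {ω | c < |∑ i, (ξ i ω ^ 2 - v i)|} ≤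
      ENNReal.ofReal (2 * exp (-t * c + 2 * t ^ 2 * ∑ i, (v i : ℝ) ^ 2)) := by
  set Y : ι → Ω → ℝ := fun i ω => ξ i ω ^ 2 - v i with hY
  have hYm : ∀ i, Measurable (Y i) := fun i => ((hm i).pow_const 2).sub_const _
  have hYi : iIndepFun Y P := h.comp (fun i x => x ^ 2 - (v i : ℝ)) (fun i => by fun_prop)
  have hsum : (fun ω => ∑ i, (ξ i ω ^ 2 - v i)) = ∑ i, Y i := by ext ω; simp [hY]
  have habs : ∀ s : ℝ, |s| = t → ∀ i, |2 * s * v i| ≤ 1 / 4 := fun s hs i => by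
    rw [abs_mul, abs_mul, hs, abs_two, NNReal.abs_eq]; exact htv i
  have hmgf : ∀ s : ℝ, |s| = t →
      mgf (∑ i, Y i) P s ≤ exp (2 * t ^ 2 * ∑ i, (v i : ℝ) ^ 2) := fun s hs => by
    rw [hYi.mgf_sum hYm, Finset.mul_sum, Real.exp_sum]
    refine Finset.prod_le_prod (fun _ _ => mgf_nonneg) fun i _ => ?_
    rw [← hs, sq_abs]
    exact mgf_centered_sq_le (hv i) (hξ i) (habs s hs i)
  have hint : ∀ s : ℝ, |s| = t → Integrable (fun ω => exp (s * (∑ i, Y i) ω)) P := fun s hs =>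
    hYi.integrable_exp_mul_sum (t := s) hYm (s := Finset.univ)
      fun i _ => integrable_exp_mul_centered_sq (hv i) (hξ i) (habs s hs i)
  -- Exponential Markov at `t` for the upper tail and at `-t` for the lower; `t` stays free and is
  -- chosen in the application.
  have h1 := measure_ge_le_exp_mul_mgf c ht (hint t (abs_of_nonneg ht))
  have h2 := measure_le_le_exp_mul_mgf (-c) (neg_nonpos.2 ht) (hint (-t) (by simp [ht]))
  rw [ENNReal.le_ofReal_iff_toReal_le (measure_ne_top _ _) (by positivity)]
  have h3 := hmgf t (abs_of_nonneg ht)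
  have h4 := hmgf (-t) (by simp [ht])
  calc P.real {ω | c < |∑ i, (ξ i ω ^ 2 - v i)|}
      ≤ P.real ({ω | c ≤ (∑ i, Y i) ω} ∪ {ω | (∑ i, Y i) ω ≤ -c}) := by
        refine measureReal_mono fun ω (hω : c < |∑ i, (ξ i ω ^ 2 - v i)|) => ?_
        have := congrFun hsum ω
        rw [this] at hω
        rcases lt_abs.1 hω with h | h
        · exact Or.inl h.le
        · exact Or.inr (by change (∑ i, Y i) ω ≤ -c; linarith)
    _ ≤ _ := measureReal_union_le _ _
    _ ≤ exp (-t * c) * exp (2 * t ^ 2 * ∑ i, (v i : ℝ) ^ 2) +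
        exp (- -t * -c) * exp (2 * t ^ 2 * ∑ i, (v i : ℝ) ^ 2) :=
        add_le_add (h1.trans (by gcongr)) (h2.trans (by gcongr))
    _ = _ := by rw [← Real.exp_add, ← Real.exp_add]; ring_nf

end Gaussian

/-! ### Deterministic analysis: stopping and pull counts when the confidence intervals hold. -/

section Deterministic

variable {n : ℕ} {ε δ : ℝ}

theorem gradient_sqNorm (μ : EuclideanSpace ℝ (Fin n)) :
    gradient (sqNorm n) μ = (2 : ℝ) • μ := by
  apply HasGradientAt.gradient
  rw [hasGradientAt_iff_hasFDerivAt]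
  have := (hasStrictFDerivAt_norm_sq μ).hasFDerivAt
  refine this.congr_fderiv ?_
  ext y
  simp

theorem gradL1_eq (μ : EuclideanSpace ℝ (Fin n)) : gradL1 n μ = 2 * ∑ i, |μ i| := by
  simp [gradL1, gradient_sqNorm, abs_mul, Finset.mul_sum]

theorem two_le_log (hn : 1 ≤ n) (hδ0 : 0 < δ) (hδ1 : δ < 1) : 2 ≤ log (12 * n / δ) := by
  have h1 : (12 : ℝ) ≤ 12 * n / δ := by
    rw [le_div_iff₀ hδ0]
    have : (1 : ℝ) ≤ n := by exact_mod_cast hn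
    nlinarith
  rw [Real.le_log_iff_exp_le (by linarith)]
  have : exp 2 = exp 1 * exp 1 := by rw [← Real.exp_add]; norm_num
  have h3 := Real.exp_one_lt_d9
  have := Real.exp_pos 1
  nlinarith

theorem log_six_pos (hδ0 : 0 < δ) (hδ1 : δ < 1) : 0 < log (6 / δ) := by
  apply Real.log_pos
  rw [lt_div_iff₀ hδ0]
  linarith

theorem log_six_le (hn : 1 ≤ n) (hδ0 : 0 < δ) : log (6 / δ) ≤ log (12 * n / δ) := by
  have : (1 : ℝ) ≤ n := by exact_mod_cast hn
  apply Real.log_le_log (by positivity)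
  gcongr
  linarith

theorem initBudget_pos (hn : 1 ≤ n) (hε : 0 < ε) (hδ0 : 0 < δ) (hδ1 : δ < 1) :
    0 < initBudget n ε δ := by
  have : (0 : ℝ) < n := by exact_mod_cast hn
  have := two_le_log hn hδ0 hδ1
  unfold initBudget
  positivity

theorem roundBudget_pos (hn : 1 ≤ n) (hε : 0 < ε) (hδ0 : 0 < δ) (hδ1 : δ < 1) (r : ℕ) :
    0 < roundBudget n ε δ r :=
  mul_pos (initBudget_pos hn hε hδ0 hδ1) (by positivity)

theorem roundBudget_div_le_cumPulls {r : ℕ} (hr : 1 ≤ r) :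
    roundBudget n ε δ r / n ≤ cumPulls n ε δ r := by
  refine (Nat.le_ceil _).trans ?_
  exact_mod_cast Finset.single_le_sum (f := unifPulls n ε δ) (fun _ _ => Nat.zero_le _)
    (Finset.mem_Icc.2 ⟨hr, le_rfl⟩)

theorem cumPulls_pos (hn : 1 ≤ n) (hε : 0 < ε) (hδ0 : 0 < δ) (hδ1 : δ < 1) {r : ℕ}
    (hr : 1 ≤ r) : (0 : ℝ) < cumPulls n ε δ r := by
  have : (0 : ℝ) < n := by exact_mod_cast hn
  exact (div_pos (roundBudget_pos hn hε hδ0 hδ1 r) this).trans_le (roundBudget_div_le_cumPulls hr)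

variable {X : Fin n → ℕ → ℝ} {μ : EuclideanSpace ℝ (Fin n)}

theorem gradLower_nonneg (r : ℕ) (i : Fin n) : 0 ≤ gradLower X ε δ r i := le_max_right _ _

theorem confWidth_nonneg (r : ℕ) : 0 ≤ confWidth n ε δ r := Real.sqrt_nonneg _

theorem freq_nonneg (r : ℕ) (i : Fin n) : 0 ≤ freq X ε δ r i := by
  unfold freq
  split_ifs
  · positivity
  · exact div_nonneg (gradLower_nonneg r i) (Finset.sum_nonneg fun k _ => gradLower_nonneg r k)

theorem sum_freq (hn : 1 ≤ n) (r : ℕ) : ∑ i, freq X ε δ r i = 1 := by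
  have : (n : ℝ) ≠ 0 := by positivity
  unfold freq
  split_ifs with h
  · simp [this]
  · rw [← Finset.sum_div, div_self h]

theorem freq_mul_le_finalPulls (hn : 1 ≤ n) (hε : 0 < ε) (hδ0 : 0 < δ) (hδ1 : δ < 1) (r : ℕ)
    (i : Fin n) : freq X ε δ r i * roundBudget n ε δ r ≤ finalPulls X ε δ r i := by
  refine le_trans ?_ (Nat.le_ceil _)
  have := roundBudget_pos hn hε hδ0 hδ1 r
  gcongr
  simp

theorem roundBudget_div_le_finalPulls (hn : 1 ≤ n) (hε : 0 < ε) (hδ0 : 0 < δ) (hδ1 : δ < 1)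
    (r : ℕ) (i : Fin n) : roundBudget n ε δ r / n ≤ finalPulls X ε δ r i := by
  refine le_trans ?_ (Nat.le_ceil _)
  have := roundBudget_pos hn hε hδ0 hδ1 r
  rw [div_eq_inv_mul, ← one_div]
  gcongr
  linarith [freq_nonneg (X := X) (ε := ε) (δ := δ) r i]

theorem finalPulls_pos (hn : 1 ≤ n) (hε : 0 < ε) (hδ0 : 0 < δ) (hδ1 : δ < 1) (r : ℕ)
    (i : Fin n) : (0 : ℝ) < finalPulls X ε δ r i := by
  have : (0 : ℝ) < n := by exact_mod_cast hn
  exact (div_pos (roundBudget_pos hn hε hδ0 hδ1 r) this).trans_le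
    (roundBudget_div_le_finalPulls hn hε hδ0 hδ1 r i)

/-- The confidence intervals of round `r` contain the true means. -/
def MeansCovered (X : Fin n → ℕ → ℝ) (μ : EuclideanSpace ℝ (Fin n)) (ε δ : ℝ) (r : ℕ) : Prop :=
  ∀ i, |muHat X ε δ r i - μ i| ≤ confWidth n ε δ r

theorem MeansCovered.gradLower_le {r : ℕ} (h : MeansCovered X μ ε δ r) (i : Fin n) :
    gradLower X ε δ r i ≤ |μ i| := by
  refine max_le ?_ (abs_nonneg _)
  have h1 := abs_sub_abs_le_abs_sub (muHat X ε δ r i) (μ i)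
  linarith [h i, confWidth_nonneg (n := n) (ε := ε) (δ := δ) r]

/-- Lets the observable stopping test control the unknown variance `∑ (2 μ i)² / T i` of the linear
error. -/
theorem MeansCovered.two_mul_abs_le_gradUpper {r : ℕ} (h : MeansCovered X μ ε δ r) (i : Fin n) :
    2 * |μ i| ≤ gradUpper X ε δ r i := by
  unfold gradUpper
  have h1 := abs_sub_abs_le_abs_sub (μ i) (muHat X ε δ r i)
  rw [abs_sub_comm] at h1
  linarith [h i]

/-- Since `|μ̂| ≤ gradLower + 4 C_r`, the upper bound is at most `2 gradLower + 10 C_r`; then `(a +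
b)² ≤ 2 a² + 2 b²`. -/
theorem gradUpper_sq_le (r : ℕ) (i : Fin n) :
    gradUpper X ε δ r i ^ 2 ≤ 8 * gradLower X ε δ r i ^ 2 + 200 * confWidth n ε δ r ^ 2 := by
  have h0 := confWidth_nonneg (n := n) (ε := ε) (δ := δ) r
  have h1 : gradUpper X ε δ r i ≤ 2 * gradLower X ε δ r i + 10 * confWidth n ε δ r := by
    have := le_max_left (|muHat X ε δ r i| - 4 * confWidth n ε δ r) 0
    unfold gradUpper gradLower
    linarith
  have h2 : 0 ≤ gradUpper X ε δ r i := by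
    unfold gradUpper
    positivity
  calc gradUpper X ε δ r i ^ 2
      ≤ (2 * gradLower X ε δ r i + 10 * confWidth n ε δ r) ^ 2 := by gcongr
    _ ≤ _ := by nlinarith [sq_nonneg (2 * gradLower X ε δ r i - 10 * confWidth n ε δ r)]

/-- Proportional allocation gives `T i ≥ g i * B / ∑ g`. Summed over `i`, the right side is `(∑ g)²
/ B`, the source of the squared `ℓ¹` norm. -/
theorem gradLower_sq_div_le (hn : 1 ≤ n) (hε : 0 < ε) (hδ0 : 0 < δ) (hδ1 : δ < 1) (r : ℕ)
    (i : Fin n) :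
    gradLower X ε δ r i ^ 2 / finalPulls X ε δ r i ≤
      gradLower X ε δ r i * (∑ k, gradLower X ε δ r k) / roundBudget n ε δ r := by
  have hB := roundBudget_pos hn hε hδ0 hδ1 r
  have hT := finalPulls_pos (X := X) hn hε hδ0 hδ1 r i
  have hg := gradLower_nonneg (X := X) (ε := ε) (δ := δ) r
  have hle : gradLower X ε δ r i ≤ ∑ k, gradLower X ε δ r k :=
    Finset.single_le_sum (fun k _ => hg k) (Finset.mem_univ i)
  rcases (hg i).eq_or_lt with h | h
  · simp [← h]
  · have hG : 0 < ∑ k, gradLower X ε δ r k := h.trans_le hle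
    have h1 := freq_mul_le_finalPulls (X := X) hn hε hδ0 hδ1 r i
    rw [freq, if_neg hG.ne', div_mul_eq_mul_div, div_le_iff₀ hG] at h1
    rw [div_le_div_iff₀ hT hB]
    nlinarith

theorem twelve_mul_le_four_pow {r : ℕ} (hr : 3 ≤ r) : 12 * (1 + (r : ℝ)) ≤ 4 ^ r := by
  induction r, hr using Nat.le_induction with
  | base => norm_num
  | succ r hr ih =>
    have : (3 : ℝ) ≤ r := by exact_mod_cast hr
    push_cast
    rw [pow_succ]
    linarith

theorem log_round_le (hn : 1 ≤ n) (hδ0 : 0 < δ) (hδ1 : δ < 1) {r : ℕ} (hr : 1 ≤ r) :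
    log (12 * n * (r : ℝ) ^ 2 / δ) ≤ log (12 * n / δ) * (1 + r) := by
  have hn' : (0 : ℝ) < n := by exact_mod_cast hn
  have hr' : (0 : ℝ) < r := by exact_mod_cast hr
  have h2 := two_le_log hn hδ0 hδ1
  have : 12 * n * (r : ℝ) ^ 2 / δ = 12 * n / δ * r ^ 2 := by ring
  rw [this, Real.log_mul (by positivity) (by positivity), Real.log_pow]
  have := Real.log_le_self hr'.le
  push_cast
  nlinarith

theorem initBudget_sq (n : ℕ) (ε δ : ℝ) :
    initBudget n ε δ ^ 2 = 1156 * (n : ℝ) ^ 3 * log (12 * n / δ) ^ 2 / ε ^ 2 := by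
  have : ((n : ℝ) ^ (3 / 2 : ℝ)) ^ 2 = (n : ℝ) ^ 3 := by
    rw [← Real.rpow_natCast, ← Real.rpow_mul (Nat.cast_nonneg n), ← Real.rpow_natCast]
    norm_num
  unfold initBudget
  rw [div_pow, mul_pow, mul_pow, this]
  norm_num

/-- The contribution of the confidence widths to the termination condition. -/
theorem confWidth_term_le (hn : 1 ≤ n) (hε : 0 < ε) (hδ0 : 0 < δ) (hδ1 : δ < 1) {r : ℕ}
    (hr : 3 ≤ r) :
    200 * n ^ 2 * confWidth n ε δ r ^ 2 / roundBudget n ε δ r ≤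
      ε ^ 2 / (32 * log (6 / δ)) := by
  have hn' : (0 : ℝ) < n := by exact_mod_cast hn
  have hr' : (1 : ℝ) ≤ r := by exact_mod_cast (by omega : 1 ≤ r)
  have hB := roundBudget_pos hn hε hδ0 hδ1 r
  have hc := roundBudget_div_le_cumPulls (n := n) (ε := ε) (δ := δ) (by omega : 1 ≤ r)
  have hl := two_le_log hn hδ0 hδ1
  have h6 := log_six_pos hδ0 hδ1
  have h6l := log_six_le (δ := δ) hn hδ0
  have hlr := log_round_le hn hδ0 hδ1 (by omega : 1 ≤ r)
  have h4 := twelve_mul_le_four_pow hr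
  have hBsq : roundBudget n ε δ r ^ 2 =
      1156 * (n : ℝ) ^ 3 * log (12 * n / δ) ^ 2 / ε ^ 2 * 4 ^ r := by
    rw [roundBudget, mul_pow, initBudget_sq, ← pow_mul, mul_comm r 2, pow_mul]
    norm_num
  set l := log (12 * n / δ)
  set B := roundBudget n ε δ r
  have hlr0 : 0 ≤ log (12 * n * (r : ℝ) ^ 2 / δ) := by
    apply Real.log_nonneg
    rw [le_div_iff₀ hδ0]
    have : (1 : ℝ) ≤ n := by exact_mod_cast hn
    nlinarith [mul_nonneg (sub_nonneg.2 this) (sq_nonneg (r : ℝ))]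
  have hC : confWidth n ε δ r ^ 2 ≤ 2 * (l * (1 + r)) / (B / n) := by
    rw [confWidth, Real.sq_sqrt (by positivity)]
    gcongr
  calc 200 * n ^ 2 * confWidth n ε δ r ^ 2 / B
      ≤ 200 * n ^ 2 * (2 * (l * (1 + r)) / (B / n)) / B := by gcongr
    _ = 400 * n ^ 3 * l * (1 + r) / B ^ 2 := by field_simp; norm_num
    _ = 400 / 1156 * (1 + r) * ε ^ 2 / (4 ^ r * l) := by rw [hBsq]; field_simp
    -- What remains is `(400 * 32 / 1156) * (1 + r) ≤ 4 ^ r`. The factor is below `12`, so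
    -- `twelve_mul_le_four_pow` applies; this is where `r ≥ 3` enters.
    _ ≤ ε ^ 2 / (32 * l) := by
      rw [div_le_div_iff₀ (by positivity) (by positivity)]
      have : 0 < ε ^ 2 * l := by positivity
      nlinarith
    _ ≤ ε ^ 2 / (32 * log (6 / δ)) := by gcongr

theorem MeansCovered.stopCond (hn : 1 ≤ n) (hε : 0 < ε) (hδ0 : 0 < δ) (hδ1 : δ < 1) {r : ℕ}
    (h : MeansCovered X μ ε δ r) (hr : 3 ≤ r)
    (hB : 64 * (gradL1 n μ ^ 2 * log (6 / δ) / ε ^ 2) ≤ roundBudget n ε δ r) :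
    StopCond X ε δ r := by
  have hn' : (0 : ℝ) < n := by exact_mod_cast hn
  have hBp := roundBudget_pos hn hε hδ0 hδ1 r
  have h6 := log_six_pos hδ0 hδ1
  have hg := gradLower_nonneg (X := X) (ε := ε) (δ := δ) r
  set G := ∑ k, gradLower X ε δ r k
  have hG0 : 0 ≤ G := Finset.sum_nonneg fun k _ => hg k
  have hG : 2 * G ≤ gradL1 n μ := by
    rw [gradL1_eq]
    have := Finset.sum_le_sum fun i (_ : i ∈ Finset.univ) => h.gradLower_le i
    linarith
  have hterm : ∀ i, gradUpper X ε δ r i ^ 2 / finalPulls X ε δ r i ≤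
      8 * (gradLower X ε δ r i * G / roundBudget n ε δ r) +
        200 * n * confWidth n ε δ r ^ 2 / roundBudget n ε δ r := fun i => by
    have hT := finalPulls_pos (X := X) hn hε hδ0 hδ1 r i
    have hT' := roundBudget_div_le_finalPulls (X := X) hn hε hδ0 hδ1 r i
    calc gradUpper X ε δ r i ^ 2 / finalPulls X ε δ r i
        ≤ (8 * gradLower X ε δ r i ^ 2 + 200 * confWidth n ε δ r ^ 2) / finalPulls X ε δ r i := by
          gcongr; exact gradUpper_sq_le r i
      _ = 8 * (gradLower X ε δ r i ^ 2 / finalPulls X ε δ r i) +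
          200 * confWidth n ε δ r ^ 2 / finalPulls X ε δ r i := by ring
      _ ≤ 8 * (gradLower X ε δ r i * G / roundBudget n ε δ r) +
          200 * confWidth n ε δ r ^ 2 / (roundBudget n ε δ r / n) := by
          gcongr ?_ + ?_
          · gcongr 8 * ?_
            exact gradLower_sq_div_le hn hε hδ0 hδ1 r i
          · gcongr
      _ = _ := by field_simp
  -- `2 G ≤ ‖∇f‖₁` gives `8 G² ≤ 2 ‖∇f‖₁²`, hence the factor `64 = 2 * 32` in `hB`. The gradient and
  -- the confidence widths each use half of the threshold.
  have hfirst : 8 * (G * G / roundBudget n ε δ r) ≤ ε ^ 2 / (32 * log (6 / δ)) := by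
    rw [← mul_div_assoc, div_le_div_iff₀ hBp (by positivity)]
    rw [← mul_div_assoc, div_le_iff₀ (by positivity)] at hB
    have hGG : 4 * (G * G) ≤ gradL1 n μ ^ 2 := by nlinarith
    nlinarith
  have hsecond := confWidth_term_le hn hε hδ0 hδ1 hr
  unfold StopCond
  calc ∑ i, gradUpper X ε δ r i ^ 2 / finalPulls X ε δ r i
      ≤ ∑ i, (8 * (gradLower X ε δ r i * G / roundBudget n ε δ r) +
        200 * n * confWidth n ε δ r ^ 2 / roundBudget n ε δ r) :=
        Finset.sum_le_sum fun i _ => hterm i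
    _ = 8 * (G * G / roundBudget n ε δ r) +
        200 * n ^ 2 * confWidth n ε δ r ^ 2 / roundBudget n ε δ r := by
        rw [Finset.sum_add_distrib, ← Finset.mul_sum, ← Finset.sum_div, ← Finset.sum_mul]
        simp only [Finset.sum_const, Finset.card_univ, Fintype.card_fin, nsmul_eq_mul]
        ring
    _ ≤ ε ^ 2 / (32 * log (6 / δ)) + ε ^ 2 / (32 * log (6 / δ)) := add_le_add hfirst hsecond
    _ = _ := by field_simp; norm_num

/-- When all confidence intervals contain the true means, the algorithm terminates, with a budget
of the order of the complexity. -/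
theorem exists_stopsAt (hn : 1 ≤ n) (hε : 0 < ε) (hδ0 : 0 < δ) (hδ1 : δ < 1)
    (h : ∀ r, 1 ≤ r → MeansCovered X μ ε δ r) :
    ∃ r, StopsAt X ε δ r ∧ roundBudget n ε δ r ≤
      128 * (gradL1 n μ ^ 2 * log (6 / δ) / ε ^ 2) + 8 * initBudget n ε δ := by
  classical
  have hB0 := initBudget_pos hn hε hδ0 hδ1
  have h6 := log_six_pos hδ0 hδ1
  set K := gradL1 n μ ^ 2 * log (6 / δ) / ε ^ 2
  have hK : 0 ≤ K := by positivity
  have hex : ∃ r, 1 ≤ r ∧ StopCond X ε δ r := by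
    obtain ⟨m, hm⟩ := pow_unbounded_of_one_lt (64 * K / initBudget n ε δ) one_lt_two
    refine ⟨m + 3, by omega, (h _ (by omega)).stopCond hn hε hδ0 hδ1 (by omega) ?_⟩
    rw [div_lt_iff₀ hB0] at hm
    rw [roundBudget, pow_add]
    have : 0 < (2 : ℝ) ^ m * initBudget n ε δ := by positivity
    nlinarith
  refine ⟨Nat.find hex, ⟨(Nat.find_spec hex).1, (Nat.find_spec hex).2, fun s hs1 hs hst =>
    Nat.find_min hex hs ⟨hs1, hst⟩⟩, ?_⟩
  have hmin := fun m hm => Nat.find_min hex (m := m) hm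
  generalize Nat.find hex = r at hmin
  -- A stop before round 4 costs at most `8 B₀`. Otherwise the preceding round is at least the third
  -- and failed its test, so its budget was below `64 K`, and doubling gives `128 K`.
  rcases Nat.lt_or_ge r 4 with hr | hr
  · have : (2 : ℝ) ^ r ≤ 2 ^ 3 := pow_le_pow_right₀ (by norm_num) (by omega)
    rw [roundBudget]
    nlinarith
  · obtain ⟨s, rfl⟩ : ∃ s, r = s + 1 := ⟨r - 1, by omega⟩
    have hs : roundBudget n ε δ s < 64 * K := by
      by_contra! hcon
      exact hmin s (by omega) ⟨by omega,
        (h s (by omega)).stopCond hn hε hδ0 hδ1 (by omega) hcon⟩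
    have : roundBudget n ε δ (s + 1) = 2 * roundBudget n ε δ s := by
      simp only [roundBudget, pow_succ]; ring
    linarith

theorem unifPulls_le (hn : 1 ≤ n) (hB : n ≤ initBudget n ε δ) (r : ℕ) :
    (unifPulls n ε δ r : ℝ) ≤ 2 * roundBudget n ε δ r / n := by
  have hn' : (0 : ℝ) < n := by exact_mod_cast hn
  have hB0 : 0 ≤ initBudget n ε δ := hn'.le.trans hB
  have h1 : 1 ≤ roundBudget n ε δ r / n := by
    rw [one_le_div hn', roundBudget]
    have : (1 : ℝ) ≤ 2 ^ r := one_le_pow₀ one_le_two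
    nlinarith
  have := Nat.ceil_lt_add_one (zero_le_one.trans h1)
  rw [unifPulls, mul_div_assoc]
  linarith

theorem sum_roundBudget_le (hB0 : 0 ≤ initBudget n ε δ) (r : ℕ) :
    ∑ l ∈ Finset.Icc 1 r, roundBudget n ε δ l ≤ 2 * roundBudget n ε δ r := by
  induction r with
  | zero => simp [roundBudget, hB0]
  | succ r ih =>
    rw [Finset.sum_Icc_succ_top (by omega)]
    have : roundBudget n ε δ (r + 1) = 2 * roundBudget n ε δ r := by
      simp only [roundBudget, pow_succ]; ring
    linarith

/-- With `n ≤ B₀`, rounding at most doubles each uniform phase, and the budgets sum geometrically to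
at most `2 B_r`: together `4 B_r`. The final phase takes at most `2 B_r + n ≤ 3 B_r`. -/
theorem totalPulls_le (hn : 1 ≤ n) (hB : n ≤ initBudget n ε δ) (r : ℕ) :
    (totalPulls X ε δ r : ℝ) ≤ 7 * roundBudget n ε δ r := by
  have hn' : (0 : ℝ) < n := by exact_mod_cast hn
  have hB0 : 0 ≤ initBudget n ε δ := hn'.le.trans hB
  have hBr : (n : ℝ) ≤ roundBudget n ε δ r := by
    rw [roundBudget]
    have : (1 : ℝ) ≤ 2 ^ r := one_le_pow₀ one_le_two
    nlinarith
  have hcum : (n : ℝ) * cumPulls n ε δ r ≤ 4 * roundBudget n ε δ r := by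
    calc (n : ℝ) * cumPulls n ε δ r
        ≤ n * ∑ l ∈ Finset.Icc 1 r, 2 * roundBudget n ε δ l / n := by
          unfold cumPulls
          push_cast
          gcongr with l
          exact unifPulls_le hn hB l
      _ = 2 * ∑ l ∈ Finset.Icc 1 r, roundBudget n ε δ l := by
          rw [← Finset.sum_div, ← Finset.mul_sum]; field_simp
      _ ≤ _ := by linarith [sum_roundBudget_le hB0 r]
  have hfin : ∑ i, (finalPulls X ε δ r i : ℝ) ≤ 3 * roundBudget n ε δ r := by
    calc ∑ i, (finalPulls X ε δ r i : ℝ)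
        ≤ ∑ i, ((freq X ε δ r i + 1 / n) * roundBudget n ε δ r + 1) := by
          refine Finset.sum_le_sum fun i _ => (Nat.ceil_lt_add_one ?_).le
          have := freq_nonneg (X := X) (ε := ε) (δ := δ) r i
          have := hn'.le.trans hBr
          positivity
      _ = 2 * roundBudget n ε δ r + n := by
          rw [Finset.sum_add_distrib, ← Finset.sum_mul, Finset.sum_add_distrib, sum_freq hn]
          simp only [Finset.sum_const, Finset.card_univ, Fintype.card_fin, nsmul_eq_mul]
          field_simp
          ring
      _ ≤ _ := by linarith
  unfold totalPulls
  push_cast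
  rw [Finset.sum_add_distrib]
  simp only [Finset.sum_const, Finset.card_univ, Fintype.card_fin, nsmul_eq_mul]
  linarith

theorem log_six_le_of_le_half (hδ0 : 0 < δ) (hδ : δ ≤ 1 / 2) :
    log (6 / δ) ≤ 5 * log (1 / δ) := by
  have h2 : log 2 ≤ log (1 / δ) := by
    apply Real.log_le_log two_pos
    rw [le_div_iff₀ hδ0]; linarith
  have h6 : log 6 ≤ 4 * log 2 := by
    rw [← Real.log_rpow two_pos]
    exact Real.log_le_log (by norm_num) (by norm_num)
  have : log (6 / δ) = log 6 + log (1 / δ) := by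
    rw [← Real.log_mul (by norm_num) (by positivity)]
    congr 1
    ring
  linarith

theorem log_twelve_le_of_le_half (hn : 1 ≤ n) (hδ0 : 0 < δ) (hδ : δ ≤ 1 / 2) :
    log (12 * n / δ) ≤ 5 * log (n / δ) := by
  have hn' : (1 : ℝ) ≤ n := by exact_mod_cast hn
  have h2 : log 2 ≤ log (n / δ) := by
    apply Real.log_le_log two_pos
    rw [le_div_iff₀ hδ0]; linarith
  have h12 : log 12 ≤ 4 * log 2 := by
    rw [← Real.log_rpow two_pos]
    exact Real.log_le_log (by norm_num) (by norm_num)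
  have : log (12 * n / δ) = log 12 + log (n / δ) := by
    rw [← Real.log_mul (by norm_num) (by positivity)]
    congr 1
    ring
  linarith

end Deterministic

/-! ### Probability that the intervals fail, and accuracy for fixed numbers of final pulls. -/

section Probability

variable {n : ℕ} {ε δ : ℝ} {Ω : Type*}

/-! ### Measurability of the decisions, for an arbitrary σ-algebra `m`. -/

section Measurability

variable {m : MeasurableSpace Ω} {X : Ω → Fin n → ℕ → ℝ}

theorem measurable_gradLower {r : ℕ} (h : ∀ i, Measurable fun ω => muHat (X ω) ε δ r i)
    (i : Fin n) : Measurable fun ω => gradLower (X ω) ε δ r i := by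
  have := h i
  unfold gradLower
  fun_prop

theorem measurable_gradUpper {r : ℕ} (h : ∀ i, Measurable fun ω => muHat (X ω) ε δ r i)
    (i : Fin n) : Measurable fun ω => gradUpper (X ω) ε δ r i := by
  have := h i
  unfold gradUpper
  fun_prop

theorem measurable_finalPulls {r : ℕ} (h : ∀ i, Measurable fun ω => muHat (X ω) ε δ r i)
    (i : Fin n) : Measurable fun ω => finalPulls (X ω) ε δ r i := by
  have h1 := measurable_gradLower h
  have h2 : Measurable fun ω => freq (X ω) ε δ r i := by
    unfold freq
    refine Measurable.ite ?_ (by fun_prop) (by fun_prop)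
    exact measurableSet_eq_fun (by fun_prop) measurable_const
  unfold finalPulls
  exact Nat.measurable_ceil.comp (by fun_prop)

theorem measurableSet_stopCond {r : ℕ} (h : ∀ i, Measurable fun ω => muHat (X ω) ε δ r i) :
    MeasurableSet {ω | StopCond (X ω) ε δ r} := by
  have h1 := measurable_gradUpper h
  have h2 : ∀ i, Measurable fun ω => (finalPulls (X ω) ε δ r i : ℝ) := fun i =>
    (measurable_from_nat (f := fun k : ℕ => (k : ℝ))).comp (measurable_finalPulls h i)
  unfold StopCond
  exact measurableSet_le (by fun_prop) measurable_const

theorem measurableSet_stopsAt {r : ℕ}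
    (h : ∀ s ≤ r, ∀ i, Measurable fun ω => muHat (X ω) ε δ s i) :
    MeasurableSet {ω | StopsAt (X ω) ε δ r} := by
  have : {ω | StopsAt (X ω) ε δ r} = {_ω | 1 ≤ r} ∩ ({ω | StopCond (X ω) ε δ r} ∩
      ⋂ s : ℕ, ⋂ _ : 1 ≤ s, ⋂ _ : s < r, {ω | StopCond (X ω) ε δ s}ᶜ) := by
    ext ω
    simp [StopsAt]
  rw [this]
  refine (MeasurableSet.const _).inter ((measurableSet_stopCond (h r le_rfl)).inter ?_)
  exact MeasurableSet.iInter fun s => MeasurableSet.iInter fun _ => MeasurableSet.iInter fun hs =>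
    (measurableSet_stopCond (h s hs.le)).compl

theorem measurableSet_meansCovered {r : ℕ} (h : ∀ i, Measurable fun ω => muHat (X ω) ε δ r i)
    (μ : EuclideanSpace ℝ (Fin n)) : MeasurableSet {ω | MeansCovered (X ω) μ ε δ r} := by
  simp only [MeansCovered, Set.ofPred_forall]
  exact MeasurableSet.iInter fun i =>
    measurableSet_le (by have := h i; fun_prop) measurable_const

end Measurability

theorem cumPulls_mono {r s : ℕ} (h : s ≤ r) : cumPulls n ε δ s ≤ cumPulls n ε δ r :=
  Finset.sum_le_sum_of_subset (Finset.Icc_subset_Icc_right h)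

variable {Z : Fin n → ℕ → Ω → ℝ}

/-- The table of observations with means `μ` and noises `Z`. -/
def obs (μ : EuclideanSpace ℝ (Fin n)) (Z : Fin n → ℕ → Ω → ℝ) (ω : Ω) : Fin n → ℕ → ℝ :=
  fun i j => μ i + Z i j ω

/-- The average of the noises `c, …, c + T - 1` of arm `i`. -/
def blockMean (Z : Fin n → ℕ → Ω → ℝ) (c T : ℕ) (i : Fin n) (ω : Ω) : ℝ :=
  (∑ j ∈ Finset.range T, Z i (c + j) ω) / T

variable {μ : EuclideanSpace ℝ (Fin n)}

theorem average_obs {c T : ℕ} (hT : 0 < T) (i : Fin n) (ω : Ω) :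
    (∑ j ∈ Finset.range T, obs μ Z ω i (c + j)) / T = μ i + blockMean Z c T i ω := by
  have : (T : ℝ) ≠ 0 := by positivity
  simp only [obs, blockMean, Finset.sum_add_distrib, Finset.sum_const, Finset.card_range,
    nsmul_eq_mul]
  field_simp

/-- The error of the bias-corrected estimate from `T i` samples of each arm `i` starting
at position `c`. -/
def blockError (Z : Fin n → ℕ → Ω → ℝ) (μ : EuclideanSpace ℝ (Fin n)) (c : ℕ) (T : Fin n → ℕ)
    (ω : Ω) : ℝ :=
  ∑ i, 2 * μ i * blockMean Z c (T i) i ω +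
    ∑ i, (blockMean Z c (T i) i ω ^ 2 - ((1 / (T i : ℝ≥0) : ℝ≥0) : ℝ))

theorem estimate_sub_sqNorm (hn : 1 ≤ n) (hε : 0 < ε) (hδ0 : 0 < δ) (hδ1 : δ < 1) (r : ℕ) (ω : Ω) :
    estimate (obs μ Z ω) ε δ r - sqNorm n μ =
      blockError Z μ (cumPulls n ε δ r) (finalPulls (obs μ Z ω) ε δ r) ω := by
  have h : ∀ i, muTilde (obs μ Z ω) ε δ r i =
      μ i + blockMean Z (cumPulls n ε δ r) (finalPulls (obs μ Z ω) ε δ r i) i ω := fun i =>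
    average_obs (by exact_mod_cast finalPulls_pos hn hε hδ0 hδ1 r i) i ω
  simp only [estimate, sqNorm, EuclideanSpace.norm_sq_eq, Real.norm_eq_abs, sq_abs, h, blockError]
  rw [← Finset.sum_sub_distrib, ← Finset.sum_sub_distrib, ← Finset.sum_add_distrib]
  refine Finset.sum_congr rfl fun i _ => ?_
  push_cast
  ring

variable [MeasurableSpace Ω] {P : Measure Ω}

theorem iIndepFun_blockMean (hm : ∀ i j, Measurable (Z i j))
    (hind : iIndepFun (fun p : Fin n × ℕ => Z p.1 p.2) P) (c : ℕ) (T : Fin n → ℕ) :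
    iIndepFun (fun i => blockMean Z c (T i) i) P :=
  (iIndepFun_rows hm hind).comp
    (fun i (x : ℕ → ℝ) => (∑ j ∈ Finset.range (T i), x (c + j)) / T i) fun i => by fun_prop

variable [IsProbabilityMeasure P]

theorem hasLaw_blockMean (hZ : ∀ i j, HasLaw (Z i j) (gaussianReal 0 1) P)
    (hind : iIndepFun (fun p : Fin n × ℕ => Z p.1 p.2) P) (c T : ℕ) (i : Fin n) :
    HasLaw (blockMean Z c T i) (gaussianReal 0 (1 / T)) P :=
  hasLaw_average_gaussianReal (fun j => hZ i (c + j))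
    (hind.precomp (g := fun j : ℕ => (i, c + j)) fun a b h => by simpa using h) T

/-- The confidence intervals of round `r` contain the true means with high probability. -/
theorem measure_not_meansCovered_le (hn : 1 ≤ n) (hε : 0 < ε) (hδ0 : 0 < δ) (hδ1 : δ < 1)
    (hZ : ∀ i j, HasLaw (Z i j) (gaussianReal 0 1) P)
    (hind : iIndepFun (fun p : Fin n × ℕ => Z p.1 p.2) P) {r : ℕ} (hr : 1 ≤ r) :
    P {ω | ¬ MeansCovered (obs μ Z ω) μ ε δ r} ≤ ENNReal.ofReal (δ / 6 * (1 / (r : ℝ) ^ 2)) := by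
  have hn' : (1 : ℝ) ≤ n := by exact_mod_cast hn
  have hr' : (1 : ℝ) ≤ r := by exact_mod_cast hr
  have hc := cumPulls_pos hn hε hδ0 hδ1 hr
  have hc' : 0 < cumPulls n ε δ r := by exact_mod_cast hc
  have hsub : {ω | ¬ MeansCovered (obs μ Z ω) μ ε δ r} ⊆
      ⋃ i, {ω | confWidth n ε δ r < |blockMean Z 0 (cumPulls n ε δ r) i ω|} := by
    intro ω hω
    simp only [MeansCovered, Set.mem_ofPred_eq, not_forall, not_le] at hω
    obtain ⟨i, hi⟩ := hω
    refine Set.mem_iUnion.2 ⟨i, ?_⟩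
    have := average_obs (μ := μ) (Z := Z) (c := 0) hc' i ω
    simp only [zero_add] at this
    rw [muHat, this, add_sub_cancel_left] at hi
    exact hi
  have hone : ∀ i, P {ω | confWidth n ε δ r < |blockMean Z 0 (cumPulls n ε δ r) i ω|} ≤
      ENNReal.ofReal (2 * (δ / (12 * n * (r : ℝ) ^ 2))) := fun i => by
    refine (measure_abs_gt_le_of_hasSubgaussianMGF (hasSubgaussianMGF_of_hasLaw_gaussianReal
      (hasLaw_blockMean hZ hind 0 _ i)) (confWidth_nonneg r)).trans (ENNReal.ofReal_le_ofReal ?_)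
    have hpos : 0 < 12 * n * (r : ℝ) ^ 2 / δ := by positivity
    have hlog : 0 ≤ log (12 * n * (r : ℝ) ^ 2 / δ) := by
      apply Real.log_nonneg
      rw [le_div_iff₀ hδ0]
      have : (1 : ℝ) ≤ (r : ℝ) ^ 2 := one_le_pow₀ hr'
      nlinarith
    rw [confWidth, Real.sq_sqrt (by positivity)]
    have : -(2 * log (12 * n * (r : ℝ) ^ 2 / δ) / cumPulls n ε δ r) /
        (2 * ((1 / (cumPulls n ε δ r : ℝ≥0) : ℝ≥0) : ℝ)) = -log (12 * n * (r : ℝ) ^ 2 / δ) := by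
      push_cast
      field_simp
    rw [this, Real.exp_neg, Real.exp_log hpos, inv_div]
  calc P {ω | ¬ MeansCovered (obs μ Z ω) μ ε δ r}
      ≤ ∑ i, P {ω | confWidth n ε δ r < |blockMean Z 0 (cumPulls n ε δ r) i ω|} :=
        (measure_mono hsub).trans (measure_iUnion_fintype_le _ _)
    _ ≤ ∑ _i : Fin n, ENNReal.ofReal (2 * (δ / (12 * n * (r : ℝ) ^ 2))) :=
        Finset.sum_le_sum fun i _ => hone i
    _ = ENNReal.ofReal (δ / 6 * (1 / (r : ℝ) ^ 2)) := by
        rw [← ENNReal.ofReal_sum_of_nonneg fun _ _ => by positivity]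
        congr 1
        simp only [Finset.sum_const, Finset.card_univ, Fintype.card_fin, nsmul_eq_mul]
        field_simp
        norm_num

/-- The term `r = 0` is `1 / 0 = 0`, so the series is `π² / 6`. -/
theorem sum_one_div_sq_le : ∑' r : ℕ, ENNReal.ofReal (1 / (r : ℝ) ^ 2) ≤ ENNReal.ofReal 2 := by
  rw [← ENNReal.ofReal_tsum_of_nonneg (fun _ => by positivity) hasSum_zeta_two.summable,
    hasSum_zeta_two.tsum_eq]
  apply ENNReal.ofReal_le_ofReal
  have h1 := Real.pi_lt_d2
  have h2 := Real.pi_pos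
  nlinarith

/-- All confidence intervals contain the true means with high probability. -/
theorem measure_exists_not_meansCovered_le (hn : 1 ≤ n) (hε : 0 < ε) (hδ0 : 0 < δ) (hδ1 : δ < 1)
    (hZ : ∀ i j, HasLaw (Z i j) (gaussianReal 0 1) P)
    (hind : iIndepFun (fun p : Fin n × ℕ => Z p.1 p.2) P) :
    P {ω | ∃ r, 1 ≤ r ∧ ¬ MeansCovered (obs μ Z ω) μ ε δ r} ≤ ENNReal.ofReal (δ / 3) := by
  have heq : {ω | ∃ r, 1 ≤ r ∧ ¬ MeansCovered (obs μ Z ω) μ ε δ r} =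
      ⋃ r : ℕ, {ω | 1 ≤ r ∧ ¬ MeansCovered (obs μ Z ω) μ ε δ r} := by
    ext; simp
  rw [heq]
  calc P (⋃ r : ℕ, {ω | 1 ≤ r ∧ ¬ MeansCovered (obs μ Z ω) μ ε δ r})
      ≤ ∑' r : ℕ, P {ω | 1 ≤ r ∧ ¬ MeansCovered (obs μ Z ω) μ ε δ r} := measure_iUnion_le _
    _ ≤ ∑' r : ℕ, ENNReal.ofReal (δ / 6) * ENNReal.ofReal (1 / (r : ℝ) ^ 2) := by
        refine ENNReal.tsum_le_tsum fun r => ?_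
        rw [← ENNReal.ofReal_mul (by positivity)]
        by_cases hr : 1 ≤ r
        · simpa only [hr, true_and] using measure_not_meansCovered_le hn hε hδ0 hδ1 hZ hind hr
        · simp [hr]
    _ ≤ ENNReal.ofReal (δ / 6) * ENNReal.ofReal 2 := by
        rw [ENNReal.tsum_mul_left]
        gcongr
        exact sum_one_div_sq_le
    _ = ENNReal.ofReal (δ / 3) := by
        rw [← ENNReal.ofReal_mul (by positivity)]
        congr 1
        ring

/-- Accuracy of the final estimate for deterministic numbers of final pulls. -/
theorem measure_blockError_gt_le (hn : 1 ≤ n) (hε : 0 < ε) (hδ0 : 0 < δ) (hδ1 : δ < 1)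
    (hm : ∀ i j, Measurable (Z i j)) (hZ : ∀ i j, HasLaw (Z i j) (gaussianReal 0 1) P)
    (hind : iIndepFun (fun p : Fin n × ℕ => Z p.1 p.2) P) (c : ℕ) {r : ℕ} (hr : 1 ≤ r)
    {T : Fin n → ℕ} (hT : ∀ i, roundBudget n ε δ r / n ≤ T i)
    (hvar : ∑ i, (2 * μ i) ^ 2 / T i ≤ ε ^ 2 / (16 * log (6 / δ))) :
    P {ω | ε < |blockError Z μ c T ω|} ≤ ENNReal.ofReal (δ / 3) := by
  have hn' : (1 : ℝ) ≤ n := by exact_mod_cast hn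
  have h6 := log_six_pos hδ0 hδ1
  have hl := two_le_log hn hδ0 hδ1
  have hT0 : ∀ i, (0 : ℝ) < T i := fun i =>
    (div_pos (roundBudget_pos hn hε hδ0 hδ1 r) (by linarith)).trans_le (hT i)
  have hB0 := initBudget_pos hn hε hδ0 hδ1
  have hTi : ∀ i, 2 * initBudget n ε δ / n ≤ T i := fun i => by
    refine le_trans ?_ (hT i)
    have : (2 : ℝ) ≤ 2 ^ r := le_self_pow₀ one_le_two (by omega)
    rw [roundBudget, mul_comm (2 : ℝ)]
    gcongr
  have hlaw := fun i => hasLaw_blockMean hZ hind c (T i) i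
  have hindep := iIndepFun_blockMean hm hind c T
  have hmeas : ∀ i, Measurable (blockMean Z c (T i) i) := fun i => by
    unfold blockMean; fun_prop
  have hsub := HasSubgaussianMGF.sum_of_iIndepFun (s := Finset.univ)
    (hindep.comp (fun i x => 2 * μ i * x) fun i => by fun_prop)
    (fun i _ => hasSubgaussianMGF_const_mul
      (hasSubgaussianMGF_of_hasLaw_gaussianReal (hlaw i)) (2 * μ i))
  -- At deviation `ε / 2` with variance proxy `ε² / (16 log (6/δ))` the exponent is `-2 log (6/δ)`,
  -- so the tail is `2 (δ/6)² ≤ δ / 18`.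
  have hlin : P {ω | ε / 2 < |∑ i, 2 * μ i * blockMean Z c (T i) i ω|} ≤
      ENNReal.ofReal (δ / 18) := by
    have hw : (0 : ℝ) ≤ ε ^ 2 / (16 * log (6 / δ)) := by positivity
    have h1 := measure_abs_gt_le_of_hasSubgaussianMGF
      (hasSubgaussianMGF_mono hsub (c' := (ε ^ 2 / (16 * log (6 / δ))).toNNReal) ?_)
      (c := ε / 2) (by positivity)
    · refine h1.trans (ENNReal.ofReal_le_ofReal ?_)
      have : -(ε / 2) ^ 2 / (2 * (ε ^ 2 / (16 * log (6 / δ)))) =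
          -log (6 / δ) + -log (6 / δ) := by
        field_simp
        norm_num
      rw [Real.coe_toNNReal _ hw, this, Real.exp_add, Real.exp_neg, Real.exp_log (by positivity),
        inv_div]
      nlinarith
    · rw [← NNReal.coe_le_coe]
      rw [Real.coe_toNNReal _ hw]
      push_cast
      refine le_of_eq_of_le (Finset.sum_congr rfl fun i _ => ?_) hvar
      rw [Real.coe_toNNReal _ (sq_nonneg _)]
      ring
  -- With `l = log (12 n / δ)`, the choice `t = 4 l / ε` makes the main term `-t ε / 2 = -2 l`.
  -- Since `T i ≥ 2 B₀ / n`, the second-order term is at most `32 / 4624`, absorbed by one `l ≥ 2`.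
  have hquad : P {ω | ε / 2 < |∑ i, (blockMean Z c (T i) i ω ^ 2 -
      ((1 / (T i : ℝ≥0) : ℝ≥0) : ℝ))|} ≤ ENNReal.ofReal (δ / 6) := by
    have h1 := measure_abs_sum_centered_sq_gt_le hmeas (v := fun i => 1 / (T i : ℝ≥0))
      (fun i => by have := (hT0 i).ne'; simpa using this) hlaw hindep
      (t := 4 * log (12 * n / δ) / ε) (by positivity) (fun i => ?_) (ε / 2)
    · refine h1.trans (ENNReal.ofReal_le_ofReal ?_)
      have hsum : ∑ i, (((1 / (T i : ℝ≥0) : ℝ≥0) : ℝ)) ^ 2 ≤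
          ε ^ 2 / (4624 * log (12 * n / δ) ^ 2) := by
        calc ∑ i, (((1 / (T i : ℝ≥0) : ℝ≥0) : ℝ)) ^ 2
            ≤ ∑ _i : Fin n, (1 / (2 * initBudget n ε δ / n)) ^ 2 := by
              refine Finset.sum_le_sum fun i _ => ?_
              push_cast
              gcongr
              exact hTi i
          _ = n ^ 3 / (4 * initBudget n ε δ ^ 2) := by
              simp only [Finset.sum_const, Finset.card_univ, Fintype.card_fin, nsmul_eq_mul]
              field_simp
              norm_num
          _ = ε ^ 2 / (4624 * log (12 * n / δ) ^ 2) := by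
              rw [initBudget_sq]
              field_simp
              norm_num
      have hexp : -(4 * log (12 * n / δ) / ε) * (ε / 2) + 2 * (4 * log (12 * n / δ) / ε) ^ 2 *
          ∑ i, (((1 / (T i : ℝ≥0) : ℝ≥0) : ℝ)) ^ 2 ≤ -log (12 * n / δ) := by
        calc _ ≤ -(4 * log (12 * n / δ) / ε) * (ε / 2) + 2 * (4 * log (12 * n / δ) / ε) ^ 2 *
              (ε ^ 2 / (4624 * log (12 * n / δ) ^ 2)) := by gcongr
          _ = -2 * log (12 * n / δ) + 32 / 4624 := by field_simp; ring
          _ ≤ _ := by linarith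
      calc _ ≤ 2 * exp (-log (12 * n / δ)) := by gcongr
        _ = δ / (6 * n) := by
          rw [Real.exp_neg, Real.exp_log (by positivity), inv_div]
          field_simp
          norm_num
        _ ≤ δ / 6 := by gcongr; linarith
    -- Admissibility of `t`: from `n ≤ n ^ (3/2)`, `T i ≥ 68 l / ε`, whence `2 t / T i ≤ 8 / 68 ≤ 1
    -- / 4`.
    · have h68 : 68 * log (12 * n / δ) / ε ≤ 2 * initBudget n ε δ / n := by
        have : (n : ℝ) ≤ (n : ℝ) ^ (3 / 2 : ℝ) := by
          simpa using Real.rpow_le_rpow_of_exponent_le hn' (by norm_num : (1 : ℝ) ≤ 3 / 2)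
        calc 68 * log (12 * n / δ) / ε = 2 * (17 * 2 * n * log (12 * n / δ) / ε) / n := by
              field_simp; norm_num
          _ ≤ _ := by unfold initBudget; gcongr
      have h2 : 68 * log (12 * n / δ) / ε ≤ T i := h68.trans (hTi i)
      push_cast
      rw [mul_one_div, div_le_iff₀ (hT0 i)]
      have h3 : 2 * (4 * log (12 * n / δ) / ε) = 8 / 68 * (68 * log (12 * n / δ) / ε) := by ring
      rw [h3]
      linarith [hT0 i]
  calc P {ω | ε < |blockError Z μ c T ω|}
      ≤ P ({ω | ε / 2 < |∑ i, 2 * μ i * blockMean Z c (T i) i ω|} ∪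
        {ω | ε / 2 < |∑ i, (blockMean Z c (T i) i ω ^ 2 -
          ((1 / (T i : ℝ≥0) : ℝ≥0) : ℝ))|}) := by
        refine measure_mono fun ω (hω : ε < |blockError Z μ c T ω|) => ?_
        by_contra hcon
        simp only [Set.mem_union, Set.mem_ofPred_eq, not_or, not_lt] at hcon
        have := hω.trans_le (abs_add_le _ _)
        linarith [hcon.1, hcon.2]
    _ ≤ ENNReal.ofReal (δ / 18) + ENNReal.ofReal (δ / 6) :=
        (measure_union_le _ _).trans (add_le_add hlin hquad)
    _ ≤ ENNReal.ofReal (δ / 3) := by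
        rw [← ENNReal.ofReal_add (by positivity) (by positivity)]
        apply ENNReal.ofReal_le_ofReal
        linarith

end Probability

/-! ### Random stopping: independence of the final samples, and assembly of the theorem. -/

section Stopping

variable {n : ℕ} {ε δ : ℝ} {Ω : Type*}

/-- The algorithm terminates in round `r` with numbers of final pulls `T`, and the confidence
intervals of that round contain the true means. -/
def stopEvent (Z : Fin n → ℕ → Ω → ℝ) (μ : EuclideanSpace ℝ (Fin n)) (ε δ : ℝ)
    (q : ℕ × (Fin n → ℕ)) : Set Ω :=
  {ω | StopsAt (obs μ Z ω) ε δ q.1 ∧ finalPulls (obs μ Z ω) ε δ q.1 = q.2 ∧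
    MeansCovered (obs μ Z ω) μ ε δ q.1}

variable {Z : Fin n → ℕ → Ω → ℝ} {μ : EuclideanSpace ℝ (Fin n)}

theorem StopsAt.unique {X : Fin n → ℕ → ℝ} {r s : ℕ} (hr : StopsAt X ε δ r)
    (hs : StopsAt X ε δ s) : r = s := by
  rcases lt_trichotomy r s with h | h | h
  · exact absurd hr.2.1 (hs.2.2 r hr.1 h)
  · exact h
  · exact absurd hs.2.1 (hr.2.2 s hs.1 h)

theorem pairwise_disjoint_stopEvent :
    Pairwise (Function.onFun Disjoint (stopEvent Z μ ε δ)) := by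
  rintro ⟨r, T⟩ ⟨s, S⟩ hne
  refine Set.disjoint_left.2 fun ω h1 h2 => hne ?_
  obtain ⟨h1, h1', -⟩ := h1
  obtain ⟨h2, h2', -⟩ := h2
  have h := h1.unique h2
  dsimp only at h h1' h2'
  subst h
  rw [← h1', ← h2']

/-- The σ-algebra is a parameter so that it can be the one generated by the samples preceding the
final phase. -/
theorem measurableSet_stopEvent {m : MeasurableSpace Ω} {q : ℕ × (Fin n → ℕ)}
    (hZ : ∀ i, ∀ j < cumPulls n ε δ q.1, Measurable (Z i j)) :
    MeasurableSet (stopEvent Z μ ε δ q) := by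
  have h : ∀ s ≤ q.1, ∀ i, Measurable fun ω => muHat (obs μ Z ω) ε δ s i := fun s hs i => by
    unfold muHat obs
    refine Measurable.div_const (Finset.measurable_fun_sum _ fun j hj => ?_) _
    exact (hZ i j ((Finset.mem_range.1 hj).trans_le (cumPulls_mono hs))).const_add _
  refine (measurableSet_stopsAt h).inter (MeasurableSet.inter ?_
    (measurableSet_meansCovered (h q.1 le_rfl) μ))
  have hf : Measurable fun ω => finalPulls (obs μ Z ω) ε δ q.1 :=
    measurable_pi_lambda _ (measurable_finalPulls (h q.1 le_rfl))
  exact hf (measurableSet_singleton q.2)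

theorem measurable_blockError {m : MeasurableSpace Ω} {c : ℕ}
    (hZ : ∀ i, ∀ j, c ≤ j → Measurable (Z i j)) (T : Fin n → ℕ) :
    Measurable (blockError Z μ c T) := by
  have : ∀ i, Measurable (blockMean Z c (T i) i) := fun i => by
    unfold blockMean
    exact Measurable.div_const (Finset.measurable_fun_sum _ fun j _ => hZ i _ (by omega)) _
  unfold blockError
  fun_prop

variable [mΩ : MeasurableSpace Ω] {P : Measure Ω}

/-- The final samples are independent of the decisions that determine how many of them are used. -/
theorem measure_stopEvent_inter (hm : ∀ i j, Measurable (Z i j))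
    (hind : iIndepFun (fun p : Fin n × ℕ => Z p.1 p.2) P) (q : ℕ × (Fin n → ℕ)) :
    P (stopEvent Z μ ε δ q ∩ {ω | ε < |blockError Z μ (cumPulls n ε δ q.1) q.2 ω|}) =
      P (stopEvent Z μ ε δ q) * P {ω | ε < |blockError Z μ (cumPulls n ε δ q.1) q.2 ω|} := by
  set c := cumPulls n ε δ q.1
  let m : Fin n × ℕ → MeasurableSpace Ω := fun p => MeasurableSpace.comap (Z p.1 p.2) inferInstance
  have hle : ∀ p, m p ≤ mΩ := fun p => (hm p.1 p.2).comap_le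
  -- The stopping decision uses only samples with index below `c`, and the final block only those
  -- from `c` on; disjoint index sets generate independent σ-algebras.
  have hS : Disjoint {p : Fin n × ℕ | p.2 < c} {p : Fin n × ℕ | c ≤ p.2} :=
    Set.disjoint_left.2 fun p (h1 : p.2 < c) (h2 : c ≤ p.2) => absurd h1 (not_lt.2 h2)
  have hI := indep_iSup_of_disjoint hle hind.iIndep hS
  have hmeas : ∀ (S : Set (Fin n × ℕ)) (p : Fin n × ℕ), p ∈ S →
      Measurable[⨆ p ∈ S, m p] (Z p.1 p.2) := fun S p hp =>
    (comap_measurable (Z p.1 p.2)).mono (le_iSup₂ (f := fun p (_ : p ∈ S) => m p) p hp) le_rfl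
  refine (Indep_iff _ _ P).1 hI _ _ ?_ ?_
  · exact measurableSet_stopEvent fun i j hj => hmeas _ (i, j) hj
  · have := measurable_blockError (μ := μ) (m := ⨆ p ∈ {p : Fin n × ℕ | c ≤ p.2}, m p)
      (fun i j hj => hmeas _ (i, j) hj) q.2
    exact this (measurableSet_lt measurable_const (by fun_prop) : MeasurableSet {x : ℝ | ε < |x|})

variable [IsProbabilityMeasure P]

/-- The requirements of `measure_blockError_gt_le` on `(r, T)` are deterministic, so one outcome in
the event certifies them. Coverage is part of `stopEvent` because that outcome must give `2 |μ i| ≤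
gradUpper`. -/
theorem measure_stopEvent_inter_le (hn : 1 ≤ n) (hε : 0 < ε) (hδ0 : 0 < δ) (hδ1 : δ < 1)
    (hm : ∀ i j, Measurable (Z i j)) (hZ : ∀ i j, HasLaw (Z i j) (gaussianReal 0 1) P)
    (hind : iIndepFun (fun p : Fin n × ℕ => Z p.1 p.2) P) (q : ℕ × (Fin n → ℕ)) :
    P (stopEvent Z μ ε δ q ∩ {ω | ε < |blockError Z μ (cumPulls n ε δ q.1) q.2 ω|}) ≤
      P (stopEvent Z μ ε δ q) * ENNReal.ofReal (δ / 3) := by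
  rcases (stopEvent Z μ ε δ q).eq_empty_or_nonempty with h | ⟨ω, hround, hT, hcov⟩
  · simp [h]
  · rw [measure_stopEvent_inter hm hind]
    gcongr
    refine measure_blockError_gt_le hn hε hδ0 hδ1 hm hZ hind _ hround.1
      (fun i => hT ▸ roundBudget_div_le_finalPulls hn hε hδ0 hδ1 q.1 i) ?_
    refine le_trans (Finset.sum_le_sum fun i _ => ?_) hround.2.1
    rw [hT, ← sq_abs, abs_mul, abs_two]
    gcongr
    exact hcov.two_mul_abs_le_gradUpper i

/-- The value returned by the algorithm is accurate with high probability. -/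
theorem measure_exists_inaccurate_le (hn : 1 ≤ n) (hε : 0 < ε) (hδ0 : 0 < δ) (hδ1 : δ < 1)
    (hm : ∀ i j, Measurable (Z i j)) (hZ : ∀ i j, HasLaw (Z i j) (gaussianReal 0 1) P)
    (hind : iIndepFun (fun p : Fin n × ℕ => Z p.1 p.2) P) :
    P {ω | ∃ r, StopsAt (obs μ Z ω) ε δ r ∧ MeansCovered (obs μ Z ω) μ ε δ r ∧
      ε < |estimate (obs μ Z ω) ε δ r - sqNorm n μ|} ≤ ENNReal.ofReal (δ / 3) := by
  calc P {ω | ∃ r, StopsAt (obs μ Z ω) ε δ r ∧ MeansCovered (obs μ Z ω) μ ε δ r ∧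
        ε < |estimate (obs μ Z ω) ε δ r - sqNorm n μ|}
      ≤ P (⋃ q, stopEvent Z μ ε δ q ∩
          {ω | ε < |blockError Z μ (cumPulls n ε δ q.1) q.2 ω|}) := by
        refine measure_mono ?_
        rintro ω ⟨r, hround, hcov, herr⟩
        rw [estimate_sub_sqNorm hn hε hδ0 hδ1] at herr
        exact Set.mem_iUnion.2 ⟨(r, finalPulls (obs μ Z ω) ε δ r), ⟨hround, rfl, hcov⟩, herr⟩
    _ ≤ ∑' q, P (stopEvent Z μ ε δ q ∩
          {ω | ε < |blockError Z μ (cumPulls n ε δ q.1) q.2 ω|}) := measure_iUnion_le _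
    _ ≤ ∑' q, P (stopEvent Z μ ε δ q) * ENNReal.ofReal (δ / 3) :=
        ENNReal.tsum_le_tsum fun q => measure_stopEvent_inter_le hn hε hδ0 hδ1 hm hZ hind q
    -- The events are disjoint, so their probabilities sum to at most `1`.
    _ = P (⋃ q, stopEvent Z μ ε δ q) * ENNReal.ofReal (δ / 3) := by
        rw [ENNReal.tsum_mul_right, measure_iUnion pairwise_disjoint_stopEvent
          fun q => measurableSet_stopEvent fun i j _ => hm i j]
    _ ≤ 1 * ENNReal.ofReal (δ / 3) := by gcongr; exact prob_le_one
    _ = ENNReal.ofReal (δ / 3) := one_mul _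

/-- The guarantees of the algorithm, for a given table of observations and constant `C`. -/
def Succeeds (C : ℝ) (X : Fin n → ℕ → ℝ) (μ : EuclideanSpace ℝ (Fin n)) (ε δ : ℝ) : Prop :=
  ∃ r : ℕ, StopsAt X ε δ r ∧ |estimate X ε δ r - sqNorm n μ| ≤ ε ∧
    ((n : ℝ) ≤ initBudget n ε δ →
      (totalPulls X ε δ r : ℝ) ≤
        C * (gradL1 n μ ^ 2 * log (6 / δ) / ε ^ 2 +
          (n : ℝ) ^ (3 / 2 : ℝ) * log (12 * n / δ) / ε) ∧
      (δ ≤ 1 / 2 →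
        (totalPulls X ε δ r : ℝ) ≤
          C * (gradL1 n μ ^ 2 * log (1 / δ) / ε ^ 2 +
            (n : ℝ) ^ (3 / 2 : ℝ) * log (n / δ) / ε)))

/-- The constants are `7 * 128 = 896` and `7 * 8 * 34 = 1904`; for `δ ≤ 1 / 2` simplifying the
logarithms costs a further factor `5`, still below `10000`. -/
theorem succeeds_of_covered_of_accurate (hn : 1 ≤ n) (hε : 0 < ε) (hδ0 : 0 < δ) (hδ1 : δ < 1)
    {X : Fin n → ℕ → ℝ} (hcov : ∀ r, 1 ≤ r → MeansCovered X μ ε δ r)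
    (hacc : ∀ r, StopsAt X ε δ r → |estimate X ε δ r - sqNorm n μ| ≤ ε) :
    Succeeds 10000 X μ ε δ := by
  obtain ⟨r, hround, hr⟩ := exists_stopsAt hn hε hδ0 hδ1 hcov
  refine ⟨r, hround, hacc r hround, fun hB => ?_⟩
  have htot := totalPulls_le (X := X) hn hB r
  have hl := two_le_log hn hδ0 hδ1
  have h6 := log_six_pos hδ0 hδ1
  have hinit : initBudget n ε δ = 34 * ((n : ℝ) ^ (3 / 2 : ℝ) * log (12 * n / δ) / ε) := by
    unfold initBudget; ring
  have h1 : 0 ≤ gradL1 n μ ^ 2 * log (6 / δ) / ε ^ 2 := by positivity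
  have h2 : 0 ≤ (n : ℝ) ^ (3 / 2 : ℝ) * log (12 * n / δ) / ε := by positivity
  rw [hinit] at hr
  refine ⟨by linarith, fun hδ => ?_⟩
  have h3 : gradL1 n μ ^ 2 * log (6 / δ) / ε ^ 2 ≤
      5 * (gradL1 n μ ^ 2 * log (1 / δ) / ε ^ 2) := by
    calc _ ≤ gradL1 n μ ^ 2 * (5 * log (1 / δ)) / ε ^ 2 := by
          gcongr; exact log_six_le_of_le_half hδ0 hδ
      _ = _ := by ring
  have h4 : (n : ℝ) ^ (3 / 2 : ℝ) * log (12 * n / δ) / ε ≤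
      5 * ((n : ℝ) ^ (3 / 2 : ℝ) * log (n / δ) / ε) := by
    calc _ ≤ (n : ℝ) ^ (3 / 2 : ℝ) * (5 * log (n / δ)) / ε := by
          gcongr; exact log_twelve_le_of_le_half hn hδ0 hδ
      _ = _ := by ring
  linarith

theorem measure_succeeds_of_measurable (hn : 1 ≤ n) (hε : 0 < ε) (hδ0 : 0 < δ) (hδ1 : δ < 1)
    (hm : ∀ i j, Measurable (Z i j)) (hZ : ∀ i j, HasLaw (Z i j) (gaussianReal 0 1) P)
    (hind : iIndepFun (fun p : Fin n × ℕ => Z p.1 p.2) P) :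
    ENNReal.ofReal (1 - δ) ≤ P {ω | Succeeds 10000 (obs μ Z ω) μ ε δ} := by
  set G := {ω | Succeeds 10000 (obs μ Z ω) μ ε δ}
  have hsub : Gᶜ ⊆ {ω | ∃ r, 1 ≤ r ∧ ¬ MeansCovered (obs μ Z ω) μ ε δ r} ∪
      {ω | ∃ r, StopsAt (obs μ Z ω) ε δ r ∧ MeansCovered (obs μ Z ω) μ ε δ r ∧
        ε < |estimate (obs μ Z ω) ε δ r - sqNorm n μ|} := by
    intro ω hω
    by_contra hcon
    simp only [Set.mem_union, Set.mem_ofPred_eq, not_or, not_exists, not_and, not_not,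
      not_lt] at hcon
    exact hω (succeeds_of_covered_of_accurate hn hε hδ0 hδ1 hcon.1
      fun r hr => hcon.2 r hr (hcon.1 r hr.1))
  have hbad : P Gᶜ ≤ ENNReal.ofReal δ := by
    calc P Gᶜ ≤ ENNReal.ofReal (δ / 3) + ENNReal.ofReal (δ / 3) :=
          (measure_mono hsub).trans ((measure_union_le _ _).trans (add_le_add
            (measure_exists_not_meansCovered_le hn hε hδ0 hδ1 hZ hind)
            (measure_exists_inaccurate_le hn hε hδ0 hδ1 hm hZ hind)))
      _ ≤ ENNReal.ofReal δ := by
          rw [← ENNReal.ofReal_add (by positivity) (by positivity)]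
          apply ENNReal.ofReal_le_ofReal
          linarith
  -- Subadditivity suffices here, so measurability of `G` need not be shown.
  have hone : 1 ≤ P G + P Gᶜ := by
    rw [← measure_univ (μ := P), ← Set.union_compl_self G]
    exact measure_union_le _ _
  rw [ENNReal.ofReal_sub _ hδ0.le, ENNReal.ofReal_one]
  exact tsub_le_iff_right.2 (hone.trans (by gcongr))

/-- `HasLaw` yields only a.e. measurability, while the σ-algebra argument needs genuine
measurability. The noises are replaced by measurable versions; there are countably many, so almost
surely the whole table is unchanged. -/
theorem measure_succeeds (hn : 1 ≤ n) (hε : 0 < ε) (hδ0 : 0 < δ) (hδ1 : δ < 1)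
    (hZ : ∀ i j, HasLaw (Z i j) (gaussianReal 0 1) P)
    (hind : iIndepFun (fun p : Fin n × ℕ => Z p.1 p.2) P) :
    ENNReal.ofReal (1 - δ) ≤ P {ω | Succeeds 10000 (obs μ Z ω) μ ε δ} := by
  choose Z' hm hZZ' using fun i j => (hZ i j).aemeasurable
  have key := measure_succeeds_of_measurable (P := P) (μ := μ) (Z := Z') hn hε hδ0 hδ1 hm
    (fun i j => (hZ i j).congr (hZZ' i j).symm)
    ((iIndepFun_congr (f := fun p : Fin n × ℕ => Z p.1 p.2) (g := fun p => Z' p.1 p.2)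
      fun p => hZZ' p.1 p.2).1 hind)
  refine key.trans (measure_mono_ae ?_)
  have hall : ∀ᵐ ω ∂P, ∀ i j, Z i j ω = Z' i j ω :=
    ae_all_iff.2 fun i => ae_all_iff.2 fun j => hZZ' i j
  refine hall.mono fun ω hω (h : Succeeds 10000 (obs μ Z' ω) μ ε δ) => ?_
  have hobs : obs μ Z' ω = obs μ Z ω := by
    funext i j
    simp only [obs, hω]
  exact (hobs ▸ h : Succeeds 10000 (obs μ Z ω) μ ε δ)

end Stopping

end AdaptiveL2

end

theorem mainTheorem5 :
    ∃ C : ℝ, 0 < C ∧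
      ∀ (n : ℕ) (_ : 1 ≤ n) (μ : EuclideanSpace ℝ (Fin n))
        (ε δ : ℝ) (_ : 0 < ε) (_ : 0 < δ) (_ : δ < 1)
        {Ω : Type*} [MeasurableSpace Ω] (P : Measure Ω) [IsProbabilityMeasure P]
        (Z : Fin n → ℕ → Ω → ℝ)
        (_ : ∀ i j, HasLaw (Z i j) (gaussianReal 0 1) P)
        (_ : iIndepFun (fun p : Fin n × ℕ => Z p.1 p.2) P),
        let X : Ω → Fin n → ℕ → ℝ := fun ω i j => μ i + Z i j ω
        ENNReal.ofReal (1 - δ) ≤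
          P {ω | ∃ r : ℕ, AdaptiveL2.StopsAt (X ω) ε δ r ∧
            |AdaptiveL2.estimate (X ω) ε δ r - AdaptiveL2.sqNorm n μ| ≤ ε ∧
            ((n : ℝ) ≤ AdaptiveL2.initBudget n ε δ →
              (AdaptiveL2.totalPulls (X ω) ε δ r : ℝ) ≤
                C * (AdaptiveL2.gradL1 n μ ^ 2 * Real.log (6 / δ) / ε ^ 2 +
                  (n : ℝ) ^ (3 / 2 : ℝ) * Real.log (12 * n / δ) / ε) ∧
              (δ ≤ 1 / 2 →
                (AdaptiveL2.totalPulls (X ω) ε δ r : ℝ) ≤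
                  C * (AdaptiveL2.gradL1 n μ ^ 2 * Real.log (1 / δ) / ε ^ 2 +
                    (n : ℝ) ^ (3 / 2 : ℝ) * Real.log (n / δ) / ε)))} := by
  refine ⟨10000, by norm_num, ?_⟩
  intro n hn μ ε δ hε hδ0 hδ1 Ω _ P _ Z hZ hind
  exact AdaptiveL2.measure_succeeds hn hε hδ0 hδ1 hZ hind
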